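/- Let $\varepsilon,b\in(0,1)$, $\rho>1$, and let $k,N\ge 1$ and $\Delta>1$ be integers. Let $\beta,\gamma,\lambda\in\mathbb R$ with $0\le\beta\le\gamma$, $\gamma>0$, $\lambda>0$. Let $G=(V,E)$ be a finite connected graph of maximum degree $\Delta$, and let $\mu$ be the Gibbs distribution on $\{\pm1\}^V$ with $$\mu(\sigma)\propto \lambda^{\#\{v:\sigma(v)=1\}}\,\beta^{\#\{\text{edges with both ends }1\}}\,\gamma^{\#\{\text{edges with both ends }-1\}}.$$ Let $\mathrm H_{G,k}$ be the $k$-non-backtracking matrix: it is indexed by the self-avoiding walks of length $k$ in $G$, and for $P=x_0,\dots,x_k$ and $Q=z_0,\dots,z_k$ its entry $\mathrm H_{G,k}(P,Q)$ is $1$ if $x_0\ne z_k$ and $z_i=x_{i+1}$ for all $0\le i<k$, and $0$ otherwise. Assume that $$\|(\mathrm H_{G,k})^N\|_2^{1/N}=\rho ,$$ where $\|\cdot\|_2$ is the spectral norm. Assume that $\mu$ is $b$-marginally bounded: for every $\Lambda\subseteq V$, every $\tau\in\{\pm1\}^\Lambda$ of positive probability, every $u\in V\setminus\Lambda$ and every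 $x\in\{\pm1\}$ with $\mu_u(x\mid\Lambda,\tau)>0$, we have $\mu_u(x\mid\Lambda,\tau)\ge b$. Finally, for $\delta=(1-\varepsilon)/\rho$, assume that the tree recursions $$H_d(x_1,\dots,x_d)=\log\lambda+\sum_{i=1}^d\log\frac{\beta e^{x_i}+1}{e^{x_i}+\gamma}\qquad(1\le d<\Delta)$$ exhibit $\delta$-contraction, i.e. $\|\nabla H_d(y)\|_\infty\le\delta$ for all $1\le d<\Delta$ and all $y\in[-\infty,+\infty]^d$, where $\partial H_d/\partial x_i=h(x_i)$ with $h(x)=-\frac{(1-\beta\gamma)e^{x}}{(\beta e^{x}+1)(e^{x}+\gamma)}$, extended to $\pm\infty$ by its limits. Then there is a number $\widehat C=\widehat C(\Delta,\rho,N,b,k)$, depending only on $\Delta,\rho,N,b,k$, such that for every $\Lambda\subseteq V$ and every $\tau\in\{\pm1\}^\Lambda$, $$\rho\big(\mathcal I_G^{\Lambda,\tau}\big)\le\widehat C\cdot\varepsilon^{-1},$$ where $\rho(\cdot)$ denotes the spectral radius and $\mathcal I_G^{\Lambda,\tau}$ is the influence matrix, indexed by $V\setminus\Lambda$, with entries $$\mathcal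 I_G^{\Lambda,\tau}(w,u)=\mu_u(+1\mid(\Lambda,\tau),(w,+1))-\mu_u(+1\mid(\Lambda,\tau),(w,-1)),$$ the entry being $0$ if $\mu_w(+1\mid\Lambda,\tau)$ or $\mu_u(+1\mid\Lambda,\tau)$ is $0$ or $1$. -/

import Mathlib

open Filter Topology

namespace TwoSpin

/-! ### Gibbs distributions on `{±1}^V` -/

section Gibbs

variable {V : Type*} [Fintype V] [DecidableEq V]

/-- The number of vertices with spin `+1` in the configuration `σ`. Spins are the elements
`1` and `-1` of `ℤˣ`. -/
def numPlus (σ : V → ℤˣ) : ℕ :=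
  (Finset.univ.filter fun v => σ v = 1).card

/-- The number of edges of `G` with both ends assigned the spin `s` by `σ`. -/
def numMono (G : SimpleGraph V) [DecidableRel G.Adj] (s : ℤˣ) (σ : V → ℤˣ) : ℕ :=
  (G.edgeFinset.filter fun e => ∀ v ∈ e, σ v = s).card

/-- The unnormalised weight of `σ`. -/
noncomputable def weight (G : SimpleGraph V) [DecidableRel G.Adj] (β γ lam : ℝ)
    (σ : V → ℤˣ) : ℝ :=
  lam ^ numPlus σ * β ^ numMono G 1 σ * γ ^ numMono G (-1) σ

/-- The partition function. -/
noncomputable def partitionFunction (G : SimpleGraph V) [DecidableRel G.Adj]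
    (β γ lam : ℝ) : ℝ :=
  ∑ σ : V → ℤˣ, weight G β γ lam σ

/-- The probability mass function of the Gibbs distribution on `G` with parameters
`(β, γ, lam)`. -/
noncomputable def gibbs (G : SimpleGraph V) [DecidableRel G.Adj] (β γ lam : ℝ)
    (σ : V → ℤˣ) : ℝ :=
  weight G β γ lam σ / partitionFunction G β γ lam

open Classical in
/-- The probability of the event `A` under the mass function `μ`. -/
noncomputable def prob (μ : (V → ℤˣ) → ℝ) (A : Set (V → ℤˣ)) : ℝ :=
  ∑ σ with σ ∈ A, μ σ

/-- The conditional probability of `A` given `B` (zero by convention if `B` has probability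
zero). -/
noncomputable def condProb (μ : (V → ℤˣ) → ℝ) (A B : Set (V → ℤˣ)) : ℝ :=
  prob μ (A ∩ B) / prob μ B

/-- The configurations that agree with the pinning `τ` at `Λ`. -/
def pinned (Λ : Finset V) (τ : {v // v ∈ Λ} → ℤˣ) : Set (V → ℤˣ) :=
  {σ | ∀ v : {v // v ∈ Λ}, σ v = τ v}

/-- The configurations with spin `s` at `u`. -/
def spinAt (u : V) (s : ℤˣ) : Set (V → ℤˣ) :=
  {σ | σ u = s}

/-- The marginal `μ_u(s | Λ, τ)`. -/
noncomputable def marginal (μ : (V → ℤˣ) → ℝ) (Λ : Finset V) (τ : {v // v ∈ Λ} → ℤˣ)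
    (u : V) (s : ℤˣ) : ℝ :=
  condProb μ (spinAt u s) (pinned Λ τ)

/-- `b`-marginal boundedness: every spin in the support of a conditional marginal of an
unpinned vertex has conditional probability at least `b`. -/
def MarginallyBounded (μ : (V → ℤˣ) → ℝ) (b : ℝ) : Prop :=
  ∀ (Λ : Finset V) (τ : {v // v ∈ Λ} → ℤˣ), 0 < prob μ (pinned Λ τ) →
    ∀ u ∉ Λ, ∀ s : ℤˣ, 0 < marginal μ Λ τ u s → b ≤ marginal μ Λ τ u s

open Classical in
/-- The pairwise influence matrix, indexed by the unpinned vertices. The entry `(w, u)` is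
`μ_u(+1 | (Λ, τ), (w, +1)) - μ_u(+1 | (Λ, τ), (w, -1))`, and it is `0` if the conditional
marginal at `w` or at `u` is deterministic. -/
noncomputable def influence (μ : (V → ℤˣ) → ℝ) (Λ : Finset V) (τ : {v // v ∈ Λ} → ℤˣ) :
    Matrix {v // v ∉ Λ} {v // v ∉ Λ} ℝ :=
  Matrix.of fun w u =>
    if marginal μ Λ τ w 1 = 0 ∨ marginal μ Λ τ w 1 = 1 ∨
        marginal μ Λ τ u 1 = 0 ∨ marginal μ Λ τ u 1 = 1 then 0
    else condProb μ (spinAt u 1) (pinned Λ τ ∩ spinAt w 1)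
      - condProb μ (spinAt u 1) (pinned Λ τ ∩ spinAt w (-1))

end Gibbs

/-! ### The `k`-non-backtracking matrix -/

section NonBacktracking

variable {V : Type*} [Fintype V] [DecidableEq V]

/-- The self-avoiding walks `x_0, …, x_k` of length `k` in `G`. -/
abbrev SAW (G : SimpleGraph V) (k : ℕ) : Type _ :=
  {x : Fin (k + 1) → V // Function.Injective x ∧ ∀ i : Fin k, G.Adj (x i.castSucc) (x i.succ)}

/-- The `k`-non-backtracking matrix: the entry `(P, Q)`, for `P = x_0, …, x_k` and
`Q = z_0, …, z_k`, is `1` if `x_0 ≠ z_k` and `z_i = x_{i+1}` for all `0 ≤ i < k`,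
and `0` otherwise. -/
def nonBacktracking (G : SimpleGraph V) (k : ℕ) : Matrix (SAW G k) (SAW G k) ℝ :=
  Matrix.of fun P Q =>
    if P.1 0 ≠ Q.1 (Fin.last k) ∧ ∀ i : Fin k, Q.1 i.castSucc = P.1 i.succ then 1 else 0

/-- The spectral norm (largest singular value) of a real square matrix. -/
noncomputable def specNorm {ι : Type*} [Fintype ι] [DecidableEq ι] (A : Matrix ι ι ℝ) : ℝ :=
  ‖Matrix.toEuclideanCLM (n := ι) (𝕜 := ℝ) A‖

/-- The spectral radius of a real square matrix: the largest modulus of its complex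
eigenvalues. -/
noncomputable def specRadius {ι : Type*} [Fintype ι] [DecidableEq ι]
    (A : Matrix ι ι ℝ) : ENNReal :=
  spectralRadius ℂ (A.map ((↑) : ℝ → ℂ))

end NonBacktracking

/-! ### Tree recursions for log-ratios -/

section Recursion

/-- The tree recursion `H_d` for log-ratios of marginals, at finite arguments. -/
noncomputable def treeRec (β γ lam : ℝ) (d : ℕ) (x : Fin d → ℝ) : ℝ :=
  Real.log lam + ∑ i, Real.log ((β * Real.exp (x i) + 1) / (Real.exp (x i) + γ))

/-- The function `h` on `[-∞, +∞]`; its values at `-∞` and `+∞` are the limits of its values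
at real arguments. -/
noncomputable def recDeriv (β γ : ℝ) : EReal → ℝ
  | ⊥ => 0
  | ⊤ => if β = 0 then -1 else 0
  | (x : ℝ) => -((1 - β * γ) * Real.exp x / ((β * Real.exp x + 1) * (Real.exp x + γ)))

/-- The gradient of `H_d` at a point of `[-∞, +∞]^d`. -/
noncomputable def gradRec (β γ : ℝ) (d : ℕ) (y : Fin d → EReal) : Fin d → ℝ :=
  fun i => recDeriv β γ (y i)

/-- `δ`-contraction of the family `H_d`, `1 ≤ d < Δ`; the norm on `Fin d → ℝ` is the
maximum norm. -/
def Contraction (β γ : ℝ) (Δ : ℕ) (δ : ℝ) : Prop :=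
  ∀ d : ℕ, 1 ≤ d → d < Δ → ∀ y : Fin d → EReal, ‖gradRec β γ d y‖ ≤ δ

/-- At finite points, `gradRec` is the vector of partial derivatives of `H_d`. -/
theorem hasDerivAt_treeRec {β γ : ℝ} (lam : ℝ) (hβ : 0 ≤ β) (hγ : 0 < γ) (d : ℕ)
    (x : Fin d → ℝ) (i : Fin d) :
    HasDerivAt (fun t => treeRec β γ lam d (Function.update x i t))
      (gradRec β γ d (fun j => (x j : EReal)) i) (x i) := by
  have key : HasDerivAt
      (fun t : ℝ => Real.log ((β * Real.exp t + 1) / (Real.exp t + γ)))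
      (gradRec β γ d (fun j => (x j : EReal)) i) (x i) := by
    have he := Real.exp_pos (x i)
    have h1 : 0 < β * Real.exp (x i) + 1 := by positivity
    have h2 : 0 < Real.exp (x i) + γ := by positivity
    have hd := ((((Real.hasDerivAt_exp (x i)).const_mul β).add_const 1).fun_div
      ((Real.hasDerivAt_exp (x i)).add_const γ) h2.ne').log (div_pos h1 h2).ne'
    convert hd using 1
    change -((1 - β * γ) * Real.exp (x i) /
      ((β * Real.exp (x i) + 1) * (Real.exp (x i) + γ))) = _
    field_simp
    ring
  have hs : (fun t => treeRec β γ lam d (Function.update x i t)) = fun t =>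
      Real.log ((β * Real.exp t + 1) / (Real.exp t + γ)) + (Real.log lam +
        ∑ j ∈ Finset.univ.erase i,
          Real.log ((β * Real.exp (x j) + 1) / (Real.exp (x j) + γ))) := by
    funext t
    unfold treeRec
    rw [← Finset.add_sum_erase _ _ (Finset.mem_univ i), Function.update_self]
    rw [Finset.sum_congr rfl (g := fun j =>
      Real.log ((β * Real.exp (x j) + 1) / (Real.exp (x j) + γ)))]
    · ring
    · intro j hj
      rw [Function.update_of_ne (Finset.ne_of_mem_erase hj)]
  rw [hs]
  exact key.add_const _

/-- The value of `h` at `-∞` is its limit. -/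
theorem tendsto_recDeriv_atBot {β γ : ℝ} (hγ : 0 < γ) :
    Tendsto (fun x : ℝ => recDeriv β γ (x : EReal)) atBot (𝓝 (recDeriv β γ ⊥)) := by
  have he := Real.tendsto_exp_atBot
  have h : Tendsto (fun x : ℝ => -((1 - β * γ) * Real.exp x /
      ((β * Real.exp x + 1) * (Real.exp x + γ)))) atBot
      (𝓝 (-((1 - β * γ) * 0 / ((β * 0 + 1) * (0 + γ))))) :=
    ((he.const_mul _).div (((he.const_mul β).add_const 1).mul (he.add_const γ))
      (by simpa using hγ.ne')).neg
  have h0 : -((1 - β * γ) * 0 / ((β * 0 + 1) * (0 + γ))) = recDeriv β γ ⊥ := by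
    change _ = (0 : ℝ)
    simp
  rw [h0] at h
  exact h

/-- The value of `h` at `+∞` is its limit. -/
theorem tendsto_recDeriv_atTop {β γ : ℝ} (hβ : 0 ≤ β) (hγ : 0 < γ) :
    Tendsto (fun x : ℝ => recDeriv β γ (x : EReal)) atTop (𝓝 (recDeriv β γ ⊤)) := by
  have he : Tendsto (fun x : ℝ => Real.exp (-x)) atTop (𝓝 0) :=
    Real.tendsto_exp_neg_atTop_nhds_zero
  rcases hβ.eq_or_lt with rfl | hβ
  · have h : Tendsto (fun x : ℝ => -(1 / (1 + γ * Real.exp (-x)))) atTop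
        (𝓝 (-(1 / (1 + γ * 0)))) :=
      (tendsto_const_nhds.div ((he.const_mul γ).const_add 1) (by simp)).neg
    have h0 : -(1 / (1 + γ * 0)) = recDeriv 0 γ ⊤ := by
      change _ = if (0 : ℝ) = 0 then (-1 : ℝ) else 0
      simp
    rw [h0] at h
    refine h.congr fun x => ?_
    change _ = -((1 - 0 * γ) * Real.exp x / ((0 * Real.exp x + 1) * (Real.exp x + γ)))
    have := Real.exp_pos x
    rw [Real.exp_neg]
    field_simp
    ring
  · have h : Tendsto (fun x : ℝ => -((1 - β * γ) * Real.exp (-x) /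
        ((β + Real.exp (-x)) * (1 + γ * Real.exp (-x))))) atTop
        (𝓝 (-((1 - β * γ) * 0 / ((β + 0) * (1 + γ * 0))))) :=
      ((he.const_mul _).div ((he.const_add β).mul ((he.const_mul γ).const_add 1))
        (by simpa using hβ.ne')).neg
    have h0 : -((1 - β * γ) * 0 / ((β + 0) * (1 + γ * 0))) = recDeriv β γ ⊤ := by
      change _ = if β = 0 then (-1 : ℝ) else 0
      simp [hβ.ne']
    rw [h0] at h
    refine h.congr fun x => ?_
    change _ = -((1 - β * γ) * Real.exp x / ((β * Real.exp x + 1) * (Real.exp x + γ)))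
    have := Real.exp_pos x
    rw [Real.exp_neg]
    field_simp

end Recursion

end TwoSpin

/-! Let `κ` be the modulus of an eigenvalue of the influence matrix and `y ≥ 0` the entrywise
modulus of an eigenvector. The triangle inequality gives `κ y ≤ |I| y` entrywise. It suffices to
bound `|I| y` by walk counts whose `ℓ²` growth is controlled by `ρ`.

Locality of influence: conditioning on `w` deletes `w` and attaches a neighbour of spin `±1` to each
vertex adjacent to `w`. Switching these attached spins one at a time splits the influence of `w`
into contributions of its neighbours `v`. A single switch only changes the field at `v`, and the
resulting change of a marginal is exactly `h(x)` times the influence of `v` in the graph without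
`w`, where `x` is the log-ratio at `v` (`abs_sub_mixture_le`). Contraction gives a factor `δ`. Since
all bounds are uniform in the external fields, induction on the graph gives `∑ l, δ ^ l * walkSum G
y l ∅ w`, a sum over self-avoiding walks from `w` (`influenceSum_le_sum_walkSum`), without
constructing the tree of such walks.

Growth of walks: after its first `k` steps, a self-avoiding walk moves along nonzero entries of the
`k`-non-backtracking matrix. Hence the walk sums of length `l` have `ℓ²` norm at most `Δ ^ (k + N) *
ρ ^ l` times that of `y` (`sum_sq_walkSum_le`). With `δ = (1 - ε) / ρ` the series over `l` is
geometric with ratio `1 - ε`, so `κ ≤ Δ ^ (k + N) / ε`. -/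

namespace TwoSpin

/-! ### Weights under external fields: the effect of one vertex -/

section Weights

variable {V : Type*} [Fintype V] [DecidableEq V]

/-- The total mass of a weight function on configurations. -/
def total (W : (V → ℤˣ) → ℝ) : ℝ := ∑ σ, W σ

/-- The weight function `W` multiplied by a function of the spin at `v`. -/
def tilt (W : (V → ℤˣ) → ℝ) (v : V) (φ : ℤˣ → ℝ) : (V → ℤˣ) → ℝ :=
  fun σ => W σ * φ (σ v)

/-- The indicator function of the spin `s`. -/
def spinInd (s : ℤˣ) : ℤˣ → ℝ := fun t => if t = s then 1 else 0

/-- The probability of spin `+1` at `u` under the normalisation of `W`. -/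
noncomputable def plusProb (W : (V → ℤˣ) → ℝ) (u : V) : ℝ :=
  total (tilt W u (spinInd 1)) / total W

omit [Fintype V] [DecidableEq V] in
theorem tilt_comm (W : (V → ℤˣ) → ℝ) (u v : V) (φ ψ : ℤˣ → ℝ) :
    tilt (tilt W u φ) v ψ = tilt (tilt W v ψ) u φ := by
  funext σ; simp only [tilt]; ring

theorem spinInd_nonneg (s t : ℤˣ) : 0 ≤ spinInd s t := by
  unfold spinInd; split_ifs <;> norm_num

theorem spinInd_le_one (s t : ℤˣ) : spinInd s t ≤ 1 := by
  unfold spinInd; split_ifs <;> norm_num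

theorem eq_spinInd_combination (φ : ℤˣ → ℝ) (t : ℤˣ) :
    φ t = φ 1 * spinInd 1 t + φ (-1) * spinInd (-1) t := by
  rcases Int.units_eq_one_or t with rfl | rfl <;> simp [spinInd]

theorem total_tilt (W : (V → ℤˣ) → ℝ) (v : V) (φ : ℤˣ → ℝ) :
    total (tilt W v φ) =
      φ 1 * total (tilt W v (spinInd 1)) + φ (-1) * total (tilt W v (spinInd (-1))) := by
  simp only [total, tilt, Finset.mul_sum, ← Finset.sum_add_distrib]
  refine Finset.sum_congr rfl fun σ _ => ?_
  rw [eq_spinInd_combination φ (σ v)]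
  ring

theorem total_nonneg {W : (V → ℤˣ) → ℝ} (hW : ∀ σ, 0 ≤ W σ) : 0 ≤ total W :=
  Finset.sum_nonneg fun σ _ => hW σ

theorem total_tilt_spinInd_le {W : (V → ℤˣ) → ℝ} (hW : ∀ σ, 0 ≤ W σ) (v : V) (s : ℤˣ) :
    total (tilt W v (spinInd s)) ≤ total W :=
  Finset.sum_le_sum fun σ _ => mul_le_of_le_one_right (hW σ) (spinInd_le_one s _)

theorem total_pos_iff {W : (V → ℤˣ) → ℝ} (hW : ∀ σ, 0 ≤ W σ) :
    0 < total W ↔ ∃ σ, 0 < W σ := by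
  unfold total
  rw [Finset.sum_pos_iff_of_nonneg fun σ _ => hW σ]
  simp

omit [Fintype V] [DecidableEq V] in
theorem tilt_nonneg {W : (V → ℤˣ) → ℝ} (hW : ∀ σ, 0 ≤ W σ) (v : V) {φ : ℤˣ → ℝ}
    (hφ : ∀ t, 0 ≤ φ t) (σ : V → ℤˣ) : 0 ≤ tilt W v φ σ :=
  mul_nonneg (hW σ) (hφ _)

/-- The interaction of two adjacent spins. -/
def edgeWeight (β γ : ℝ) (s t : ℤˣ) : ℝ :=
  (if s = 1 ∧ t = 1 then β else 1) * (if s = -1 ∧ t = -1 then γ else 1)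

theorem edgeWeight_nonneg {β γ : ℝ} (hβ : 0 ≤ β) (hγ : 0 < γ) (s t : ℤˣ) :
    0 ≤ edgeWeight β γ s t := by
  unfold edgeWeight; split_ifs <;> positivity

theorem edgeWeight_neg_one_pos {β γ : ℝ} (hγ : 0 < γ) (t : ℤˣ) :
    0 < edgeWeight β γ (-1) t := by
  have h : ¬ ((-1 : ℤˣ) = 1) := by decide
  unfold edgeWeight; simp only [h, false_and, if_false]; split_ifs <;> simp [hγ]

theorem edgeWeight_one_one (β γ : ℝ) : edgeWeight β γ 1 1 = β := by
  have h : ¬ ((1 : ℤˣ) = -1) := by decide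
  simp [edgeWeight, h]

theorem edgeWeight_one_neg_one (β γ : ℝ) : edgeWeight β γ 1 (-1) = 1 := by
  have h : ¬ ((1 : ℤˣ) = -1) := by decide
  have h' : ¬ ((-1 : ℤˣ) = 1) := by decide
  simp [edgeWeight, h, h']

theorem edgeWeight_neg_one_one (β γ : ℝ) : edgeWeight β γ (-1) 1 = 1 := by
  have h : ¬ ((1 : ℤˣ) = -1) := by decide
  have h' : ¬ ((-1 : ℤˣ) = 1) := by decide
  simp [edgeWeight, h, h']

theorem edgeWeight_neg_one_neg_one (β γ : ℝ) : edgeWeight β γ (-1) (-1) = γ := by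
  have h' : ¬ ((-1 : ℤˣ) = 1) := by decide
  simp [edgeWeight, h']

/-- Here `A`, `B` are the masses of the two spins at a vertex and `a`, `b` their parts with spin
`+1` at `u`. Cross-multiplying leaves `-(1 - β * γ) * (a * B - b * A)` in the numerator, so the
difference is exactly `h(log (A / B)) * (a / A - b / B)`. -/
theorem abs_sub_mixture_le {β γ δ A B a b : ℝ} (hβ : 0 ≤ β) (hγ : 0 < γ)
    (hδ : ∀ x : ℝ, |recDeriv β γ x| ≤ δ) (hA : 0 < A) (hB : 0 < B) :
    |(β * a + b) / (β * A + B) - (a + γ * b) / (A + γ * B)| ≤ δ * |a / A - b / B| := by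
  have h := hδ (Real.log (A / B))
  have hR : Real.exp (Real.log (A / B)) = A / B := Real.exp_log (by positivity)
  have hr : recDeriv β γ (Real.log (A / B) : ℝ) =
      -((1 - β * γ) * (A / B) / ((β * (A / B) + 1) * (A / B + γ))) := by
    change -((1 - β * γ) * Real.exp (Real.log (A / B)) / _) = _
    rw [hR]
  have e : (β * a + b) / (β * A + B) - (a + γ * b) / (A + γ * B) =
      recDeriv β γ (Real.log (A / B) : ℝ) * (a / A - b / B) := by
    rw [hr]
    have h1 : β * A + B ≠ 0 := by positivity
    have h2 : A + γ * B ≠ 0 := by positivity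
    have h3 : β * (A / B) + 1 ≠ 0 := by positivity
    have h4 : A / B + γ ≠ 0 := by positivity
    have h3' : β * (A / B) + 1 = (β * A + B) / B := by field_simp
    have h4' : A / B + γ = (A + γ * B) / B := by field_simp
    rw [h3', h4']
    field_simp
    ring
  rw [e, abs_mul]
  exact mul_le_mul_of_nonneg_right h (abs_nonneg _)

theorem total_tilt_tilt_eq_zero {W : (V → ℤˣ) → ℝ} (hW : ∀ σ, 0 ≤ W σ) {v : V} {s : ℤˣ}
    (h : ¬ 0 < total (tilt W v (spinInd s))) (u : V) :
    total (tilt (tilt W v (spinInd s)) u (spinInd 1)) = 0 := by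
  have h0 := tilt_nonneg hW v (spinInd_nonneg s)
  have h1 := total_tilt_spinInd_le h0 u 1
  have h2 := total_nonneg (tilt_nonneg h0 u (spinInd_nonneg 1))
  linarith

/-- The total influence of `v` on all vertices, weighted by `y`. -/
noncomputable def influenceSum (y : V → ℝ) (W : (V → ℤˣ) → ℝ) (v : V) : ℝ :=
  ∑ u, y u * |plusProb (tilt W v (spinInd 1)) u - plusProb (tilt W v (spinInd (-1))) u|

/-- Exchanging the spin of an outer neighbour of `v` changes the marginals by at most `δ` times
the influence of `v`. -/
theorem sum_abs_plusProb_tilt_sub_le {β γ δ c : ℝ} (hβ : 0 ≤ β) (hγ : 0 < γ) (hδ0 : 0 ≤ δ)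
    (hδ : ∀ x : ℝ, |recDeriv β γ x| ≤ δ) {y : V → ℝ} (hy : ∀ u, 0 ≤ y u)
    {W : (V → ℤˣ) → ℝ} (hW : ∀ σ, 0 ≤ W σ) (v : V) (hc : 0 ≤ c)
    (hbound : 0 < total (tilt W v (spinInd 1)) → 0 < total (tilt W v (spinInd (-1))) →
      influenceSum y W v ≤ c)
    (hpos : 0 < total (tilt W v (edgeWeight β γ 1))) :
    ∑ u, y u * |plusProb (tilt W v (edgeWeight β γ 1)) u -
      plusProb (tilt W v (edgeWeight β γ (-1))) u| ≤ δ * c := by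
  have hA0 := total_nonneg (tilt_nonneg hW v (spinInd_nonneg 1))
  have hB0 := total_nonneg (tilt_nonneg hW v (spinInd_nonneg (-1)))
  have hP : ∀ (s : ℤˣ) (u : V), plusProb (tilt W v (edgeWeight β γ s)) u =
      (edgeWeight β γ s 1 * total (tilt (tilt W v (spinInd 1)) u (spinInd 1)) +
        edgeWeight β γ s (-1) * total (tilt (tilt W v (spinInd (-1))) u (spinInd 1))) /
      (edgeWeight β γ s 1 * total (tilt W v (spinInd 1)) +
        edgeWeight β γ s (-1) * total (tilt W v (spinInd (-1)))) := by
    intro s u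
    unfold plusProb
    rw [tilt_comm, total_tilt, total_tilt W v, tilt_comm W u v, tilt_comm W u v]
  rw [total_tilt, edgeWeight_one_one, edgeWeight_one_neg_one, one_mul] at hpos
  by_cases hA : 0 < total (tilt W v (spinInd 1))
  · by_cases hB : 0 < total (tilt W v (spinInd (-1)))
    · refine le_trans ?_ (mul_le_mul_of_nonneg_left (hbound hA hB) hδ0)
      unfold influenceSum
      rw [Finset.mul_sum]
      refine Finset.sum_le_sum fun u _ => ?_
      rw [mul_left_comm]
      refine mul_le_mul_of_nonneg_left ?_ (hy u)
      rw [hP, hP, edgeWeight_one_one, edgeWeight_one_neg_one, edgeWeight_neg_one_one,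
        edgeWeight_neg_one_neg_one, one_mul, one_mul, one_mul, one_mul]
      exact abs_sub_mixture_le hβ hγ hδ hA hB
    -- If the spin at `v` is forced, both tilts merely rescale `W` by nonzero constants, and the
    -- marginals agree. Here `hpos` excludes `β = 0`.
    · have hB' : total (tilt W v (spinInd (-1))) = 0 := le_antisymm (not_lt.1 hB) hB0
      refine le_trans (le_of_eq ?_) (mul_nonneg hδ0 hc)
      refine Finset.sum_eq_zero fun u _ => ?_
      rw [hP, hP, edgeWeight_one_one, edgeWeight_one_neg_one, edgeWeight_neg_one_one,
        edgeWeight_neg_one_neg_one, total_tilt_tilt_eq_zero hW hB u, hB']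
      rw [hB', add_zero] at hpos
      have hβ' : β ≠ 0 := by rintro rfl; simp at hpos
      simp only [mul_zero, add_zero, one_mul]
      rw [mul_div_mul_left _ _ hβ', sub_self, abs_zero, mul_zero]
  · have hA' : total (tilt W v (spinInd 1)) = 0 := le_antisymm (not_lt.1 hA) hA0
    refine le_trans (le_of_eq ?_) (mul_nonneg hδ0 hc)
    refine Finset.sum_eq_zero fun u _ => ?_
    rw [hP, hP, edgeWeight_one_one, edgeWeight_one_neg_one, edgeWeight_neg_one_one,
      edgeWeight_neg_one_neg_one, total_tilt_tilt_eq_zero hW hA u, hA']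
    simp only [mul_zero, zero_add, one_mul]
    rw [mul_div_mul_left _ _ hγ.ne', sub_self, abs_zero, mul_zero]

/-- The weight function `W` with additional neighbours of spin `s` attached to the vertices
of `N`. -/
def attach (β γ : ℝ) (W : (V → ℤˣ) → ℝ) (N : Finset V) (s : ℤˣ) : (V → ℤˣ) → ℝ :=
  fun σ => W σ * ∏ v ∈ N, edgeWeight β γ s (σ v)

omit [Fintype V] [DecidableEq V] in
theorem attach_empty (β γ : ℝ) (W : (V → ℤˣ) → ℝ) (s : ℤˣ) : attach β γ W ∅ s = W := by
  funext σ
  simp [attach]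

omit [Fintype V] in
theorem attach_insert (β γ : ℝ) (W : (V → ℤˣ) → ℝ) {v : V} {N : Finset V} (hv : v ∉ N)
    (s : ℤˣ) : attach β γ W (insert v N) s = tilt (attach β γ W N s) v (edgeWeight β γ s) := by
  funext σ
  simp only [attach, tilt, Finset.prod_insert hv]
  ring

omit [Fintype V] [DecidableEq V] in
theorem attach_tilt (β γ : ℝ) (W : (V → ℤˣ) → ℝ) (v : V) (N : Finset V) (s : ℤˣ)
    (φ : ℤˣ → ℝ) : attach β γ (tilt W v φ) N s = tilt (attach β γ W N s) v φ := by
  funext σ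
  simp only [attach, tilt]
  ring

/-- A class of nonnegative weight functions closed under nonnegative changes of the external
field. -/
structure FieldClosed (S : Set ((V → ℤˣ) → ℝ)) : Prop where
  nonneg : ∀ W ∈ S, ∀ σ, 0 ≤ W σ
  tilt_mem : ∀ W ∈ S, ∀ (v : V) (φ : ℤˣ → ℝ), (∀ t, 0 ≤ φ t) → tilt W v φ ∈ S

omit [Fintype V] in
theorem FieldClosed.attach_mem {S : Set ((V → ℤˣ) → ℝ)} (hS : FieldClosed S) {β γ : ℝ}
    (hβ : 0 ≤ β) (hγ : 0 < γ) {W : (V → ℤˣ) → ℝ} (hW : W ∈ S) (N : Finset V) (s : ℤˣ) :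
    attach β γ W N s ∈ S := by
  induction N using Finset.induction_on with
  | empty => rwa [attach_empty]
  | insert v N hv ih =>
    rw [attach_insert β γ W hv]
    exact hS.tilt_mem _ ih _ _ fun t => edgeWeight_nonneg hβ hγ _ _

/-- The effect of a vertex on the remaining graph, telescoped over its neighbours `N`. -/
theorem FieldClosed.sum_abs_plusProb_attach_sub_le {S : Set ((V → ℤˣ) → ℝ)}
    (hS : FieldClosed S) {β γ δ : ℝ} (hβ : 0 ≤ β) (hγ : 0 < γ) (hδ0 : 0 ≤ δ)
    (hδ : ∀ x : ℝ, |recDeriv β γ x| ≤ δ) {y : V → ℝ} (hy : ∀ u, 0 ≤ y u) {c : V → ℝ}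
    (hc : ∀ v, 0 ≤ c v) (N : Finset V)
    (hbound : ∀ v ∈ N, ∀ W ∈ S, 0 < total (tilt W v (spinInd 1)) →
      0 < total (tilt W v (spinInd (-1))) → influenceSum y W v ≤ c v) :
    ∀ W ∈ S, 0 < total (attach β γ W N 1) →
      ∑ u, y u * |plusProb (attach β γ W N 1) u - plusProb (attach β γ W N (-1)) u| ≤
        δ * ∑ v ∈ N, c v := by
  induction N using Finset.induction_on with
  | empty => intro W _ _; simp [attach_empty]
  | insert v N hv ih =>
    intro W hW hpos
    have hm := hS.attach_mem hβ hγ hW N 1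
    -- The intermediate weight has outer spin `-1` at `v` and still `+1` on `N`: `h1` compares it
    -- with the all-plus end, `h2` with the all-minus end.
    have h1 := sum_abs_plusProb_tilt_sub_le hβ hγ hδ0 hδ hy (hS.nonneg _ hm) v (hc v)
      (hbound v (Finset.mem_insert_self v N) _ hm)
      (by rwa [← attach_insert β γ W hv])
    have hm' := hS.tilt_mem _ hW v (edgeWeight β γ (-1)) fun t => edgeWeight_nonneg hβ hγ _ _
    -- Switching from `+1` to `-1` preserves positive mass: the factors for outer spin `-1` are `1`
    -- and `γ`, whereas `β` may vanish.
    have hpos' : 0 < total (attach β γ (tilt W v (edgeWeight β γ (-1))) N 1) := by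
      rw [total_pos_iff (hS.nonneg _ (hS.attach_mem hβ hγ hm' N 1))]
      rw [attach_insert β γ W hv,
        total_pos_iff (tilt_nonneg (hS.nonneg _ hm) v (edgeWeight_nonneg hβ hγ 1))] at hpos
      obtain ⟨σ, hσ⟩ := hpos
      refine ⟨σ, ?_⟩
      rw [attach_tilt]
      exact mul_pos (pos_of_mul_pos_left hσ (edgeWeight_nonneg hβ hγ _ _))
        (edgeWeight_neg_one_pos hγ _)
    have h2 := ih (fun x hx => hbound x (Finset.mem_insert_of_mem hx)) _ hm' hpos'
    rw [attach_tilt, attach_tilt] at h2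
    rw [attach_insert β γ W hv, attach_insert β γ W hv, Finset.sum_insert hv, mul_add]
    refine le_trans ?_ (add_le_add h1 h2)
    rw [← Finset.sum_add_distrib]
    refine Finset.sum_le_sum fun u _ => ?_
    rw [← mul_add]
    exact mul_le_mul_of_nonneg_left (abs_sub_le _ _ _) (hy u)

end Weights

/-! ### Deleting vertices from the graph and induction along self-avoiding walks -/

section GraphWeights

variable {V : Type*} [Fintype V] [DecidableEq V]

/-- The contribution of the edge `e` to the weight of `σ`. -/
def edgeFactor (β γ : ℝ) (σ : V → ℤˣ) (e : Sym2 V) : ℝ :=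
  (if ∀ v ∈ e, σ v = 1 then β else 1) * (if ∀ v ∈ e, σ v = -1 then γ else 1)

theorem edgeFactor_mk (β γ : ℝ) (σ : V → ℤˣ) (v w : V) :
    edgeFactor β γ σ s(v, w) = edgeWeight β γ (σ v) (σ w) := by
  simp [edgeFactor, edgeWeight, Sym2.mem_iff]

theorem edgeFactor_nonneg {β γ : ℝ} (hβ : 0 ≤ β) (hγ : 0 < γ) (σ : V → ℤˣ) (e : Sym2 V) :
    0 ≤ edgeFactor β γ σ e := by
  unfold edgeFactor; split_ifs <;> positivity

/-- The weight function with external fields `a` on the graph `G` without the edges at the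
vertices in `X`. -/
def fieldWeight (G : SimpleGraph V) [DecidableRel G.Adj] (β γ : ℝ) (X : Finset V)
    (a : V → ℤˣ → ℝ) (σ : V → ℤˣ) : ℝ :=
  (∏ v, a v (σ v)) * ∏ e ∈ G.edgeFinset with ∀ x ∈ X, x ∉ e, edgeFactor β γ σ e

/-- The weight functions with nonnegative external fields on the graph `G` without the edges at
the vertices in `X`. -/
def fieldClass (G : SimpleGraph V) [DecidableRel G.Adj] (β γ : ℝ) (X : Finset V) :
    Set ((V → ℤˣ) → ℝ) :=
  {W | ∃ a : V → ℤˣ → ℝ, (∀ v t, 0 ≤ a v t) ∧ W = fieldWeight G β γ X a}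

theorem fieldClosed_fieldClass (G : SimpleGraph V) [DecidableRel G.Adj] {β γ : ℝ}
    (hβ : 0 ≤ β) (hγ : 0 < γ) (X : Finset V) : FieldClosed (fieldClass G β γ X) where
  nonneg := by
    rintro _ ⟨a, ha, rfl⟩ σ
    exact mul_nonneg (Finset.prod_nonneg fun v _ => ha v _)
      (Finset.prod_nonneg fun e _ => edgeFactor_nonneg hβ hγ σ e)
  tilt_mem := by
    rintro _ ⟨a, ha, rfl⟩ v φ hφ
    refine ⟨fun x t => a x t * if x = v then φ t else 1, fun x t => ?_, ?_⟩
    · exact mul_nonneg (ha x t) (by split_ifs <;> simp [hφ])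
    · funext σ
      simp only [tilt, fieldWeight, Finset.prod_mul_distrib, Finset.prod_ite_eq',
        Finset.mem_univ, if_true]
      ring

/-- Splitting off the edges at `w`. -/
theorem fieldWeight_eq_mul_prod (G : SimpleGraph V) [DecidableRel G.Adj] (β γ : ℝ)
    {X : Finset V} (a : V → ℤˣ → ℝ) {w : V} (hw : w ∉ X) (σ : V → ℤˣ) :
    fieldWeight G β γ X a σ = fieldWeight G β γ (insert w X) a σ *
      ∏ v ∈ G.neighborFinset w \ X, edgeWeight β γ (σ w) (σ v) := by
  have himg : ∏ v ∈ G.neighborFinset w \ X, edgeWeight β γ (σ w) (σ v) =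
      ∏ e ∈ G.edgeFinset.filter (fun e => ∀ x ∈ X, x ∉ e) with w ∈ e, edgeFactor β γ σ e := by
    refine Finset.prod_bij (fun v _ => s(w, v)) ?_ ?_ ?_ ?_
    · intro v hv
      simp only [Finset.mem_sdiff, SimpleGraph.mem_neighborFinset] at hv
      simp only [Finset.mem_filter, SimpleGraph.mem_edgeFinset, SimpleGraph.mem_edgeSet,
        Sym2.mem_iff, true_or, and_true]
      refine ⟨hv.1, ?_⟩
      rintro x hx (rfl | rfl)
      exacts [hw hx, hv.2 hx]
    · intro v _ v' _ h
      exact Sym2.congr_right.1 h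
    · intro e he
      simp only [Finset.mem_filter, SimpleGraph.mem_edgeFinset] at he
      obtain ⟨⟨he, hX⟩, v, rfl⟩ := he
      refine ⟨v, ?_, rfl⟩
      simp only [Finset.mem_sdiff, SimpleGraph.mem_neighborFinset]
      exact ⟨he, fun hv => hX v hv (Sym2.mem_mk_right _ _)⟩
    · intro v _
      rw [edgeFactor_mk]
  have hf : (G.edgeFinset.filter fun e => ∀ x ∈ insert w X, x ∉ e) =
      (G.edgeFinset.filter fun e => ∀ x ∈ X, x ∉ e).filter fun e => w ∉ e := by
    ext e
    simp only [Finset.mem_filter, Finset.forall_mem_insert]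
    tauto
  unfold fieldWeight
  rw [himg, hf, mul_assoc, mul_comm (Finset.prod _ _) (∏ e ∈ _ with w ∈ e, _),
    Finset.prod_filter_mul_prod_filter_not]

theorem fieldWeight_congr (G : SimpleGraph V) [DecidableRel G.Adj] (β γ : ℝ)
    {X : Finset V} {a : V → ℤˣ → ℝ} {w : V} (hw : w ∈ X) (ha : ∀ s t, a w s = a w t)
    {σ σ' : V → ℤˣ} (h : ∀ v ≠ w, σ v = σ' v) :
    fieldWeight G β γ X a σ = fieldWeight G β γ X a σ' := by
  unfold fieldWeight
  congr 1
  · refine Finset.prod_congr rfl fun v _ => ?_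
    by_cases hv : v = w
    · subst hv; exact ha _ _
    · rw [h v hv]
  · refine Finset.prod_congr rfl fun e he => ?_
    have hwe := (Finset.mem_filter.1 he).2 w hw
    have hne : ∀ v ∈ e, σ v = σ' v := fun v hv => h v fun hvw => hwe (hvw ▸ hv)
    unfold edgeFactor
    congr 1
    · exact if_congr (forall₂_congr fun v hv => by rw [hne v hv]) rfl rfl
    · exact if_congr (forall₂_congr fun v hv => by rw [hne v hv]) rfl rfl

/-- Multiplying the spin at `w` by `s` permutes the configurations and is invisible to `F`. -/
theorem sum_mul_spinInd {F : (V → ℤˣ) → ℝ} {w : V}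
    (hF : ∀ σ σ' : V → ℤˣ, (∀ v ≠ w, σ v = σ' v) → F σ = F σ') (s : ℤˣ) :
    ∑ σ, F σ * spinInd s (σ w) = ∑ σ, F σ * spinInd 1 (σ w) := by
  rw [← Equiv.sum_comp (Equiv.mulLeft (Pi.mulSingle w s : V → ℤˣ))]
  refine Finset.sum_congr rfl fun σ _ => ?_
  congr 1
  · refine hF _ _ fun v hv => ?_
    simp [Pi.mulSingle_eq_of_ne hv]
  · simp [spinInd]

/-- Conditioning on the spin of `w` removes the edges at `w` and attaches to its neighbours a
vertex with the given spin. -/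
theorem exists_attach_eq (G : SimpleGraph V) [DecidableRel G.Adj] {β γ : ℝ}
    {X : Finset V} {w : V} (hw : w ∉ X)
    {W : (V → ℤˣ) → ℝ} (hW : W ∈ fieldClass G β γ X) :
    ∃ W' ∈ fieldClass G β γ (insert w X), ∃ c : ℤˣ → ℝ, (∀ s, 0 ≤ c s) ∧
      ∀ s, ∀ f : (V → ℤˣ) → ℝ,
        (∀ σ σ' : V → ℤˣ, (∀ v ≠ w, σ v = σ' v) → f σ = f σ') →
        ∑ σ, tilt W w (spinInd s) σ * f σ =
          c s * ∑ σ, attach β γ W' (G.neighborFinset w \ X) s σ * f σ := by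
  obtain ⟨a, ha, rfl⟩ := hW
  set a₀ : V → ℤˣ → ℝ := fun v t => if v = w then 1 else a v t with ha₀
  have ha₀_nonneg : ∀ v t, 0 ≤ a₀ v t := fun v t => by
    simp only [ha₀]; split_ifs <;> simp [ha]
  have hsplit : ∀ σ, fieldWeight G β γ (insert w X) a σ =
      a w (σ w) * fieldWeight G β γ (insert w X) a₀ σ := by
    intro σ
    unfold fieldWeight
    rw [← mul_assoc, ← Finset.mul_prod_erase _ _ (Finset.mem_univ w),
      ← Finset.mul_prod_erase _ (fun v => a₀ v (σ v)) (Finset.mem_univ w)]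
    simp only [ha₀, if_true, one_mul]
    congr 2
    exact Finset.prod_congr rfl fun v hv => by rw [if_neg (Finset.ne_of_mem_erase hv)]
  -- The isolated vertex `w` is frozen at `+1`, so that one weight serves both values of `s`; the
  -- field `a w s` becomes the constant `c s`.
  have hmem : tilt (fieldWeight G β γ (insert w X) a₀) w (spinInd 1) ∈
      fieldClass G β γ (insert w X) := by
    refine ⟨fun x t => a₀ x t * if x = w then spinInd 1 t else 1, fun x t => ?_, ?_⟩
    · exact mul_nonneg (ha₀_nonneg x t) (by split_ifs <;> simp [spinInd_nonneg])
    · funext σ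
      simp only [tilt, fieldWeight, Finset.prod_mul_distrib, Finset.prod_ite_eq',
        Finset.mem_univ, if_true]
      ring
  refine ⟨_, hmem, a w, ha w, fun s f hf => ?_⟩
  set F : (V → ℤˣ) → ℝ := fun σ => fieldWeight G β γ (insert w X) a₀ σ *
    (∏ v ∈ G.neighborFinset w \ X, edgeWeight β γ s (σ v)) * f σ with hFdef
  have hF : ∀ σ σ' : V → ℤˣ, (∀ v ≠ w, σ v = σ' v) → F σ = F σ' := by
    intro σ σ' h
    simp only [hFdef]
    rw [hf σ σ' h, fieldWeight_congr G β γ (Finset.mem_insert_self w X) (by simp [ha₀]) h]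
    congr 2
    refine Finset.prod_congr rfl fun v hv => ?_
    rw [h v]
    rintro rfl
    simp at hv
  have h1 : ∀ σ, tilt (fieldWeight G β γ X a) w (spinInd s) σ * f σ =
      a w s * (F σ * spinInd s (σ w)) := by
    intro σ
    simp only [tilt, hFdef]
    rw [fieldWeight_eq_mul_prod G β γ a hw, hsplit]
    by_cases hs : σ w = s
    · rw [hs]; ring
    · simp [spinInd, hs]
  rw [Finset.sum_congr rfl fun σ _ => h1 σ, ← Finset.mul_sum, sum_mul_spinInd hF]
  congr 1
  refine Finset.sum_congr rfl fun σ _ => ?_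
  simp only [hFdef, attach, tilt]
  ring

/-- The sum of `y` over the end points of the self-avoiding walks of length `l` from `w` that
avoid `X`. -/
def walkSum (G : SimpleGraph V) [DecidableRel G.Adj] (y : V → ℝ) : ℕ → Finset V → V → ℝ
  | 0, _, w => y w
  | l + 1, X, w => ∑ v ∈ G.neighborFinset w \ X, walkSum G y l (insert w X) v

theorem walkSum_nonneg (G : SimpleGraph V) [DecidableRel G.Adj] {y : V → ℝ}
    (hy : ∀ u, 0 ≤ y u) (l : ℕ) (X : Finset V) (w : V) : 0 ≤ walkSum G y l X w := by
  induction l generalizing X w with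
  | zero => exact hy w
  | succ l ih => exact Finset.sum_nonneg fun v _ => ih _ _

theorem plusProb_nonneg {W : (V → ℤˣ) → ℝ} (hW : ∀ σ, 0 ≤ W σ) (u : V) :
    0 ≤ plusProb W u :=
  div_nonneg (total_nonneg (tilt_nonneg hW u (spinInd_nonneg 1))) (total_nonneg hW)

theorem plusProb_le_one {W : (V → ℤˣ) → ℝ} (hW : ∀ σ, 0 ≤ W σ) (u : V) :
    plusProb W u ≤ 1 :=
  div_le_one_of_le₀ (total_tilt_spinInd_le hW u 1) (total_nonneg hW)

/-- The influence of a vertex is dominated by the self-avoiding walks starting at it. -/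
theorem influenceSum_le_sum_walkSum (G : SimpleGraph V) [DecidableRel G.Adj] {β γ δ : ℝ}
    (hβ : 0 ≤ β) (hγ : 0 < γ) (hδ0 : 0 ≤ δ) (hδ : ∀ x : ℝ, |recDeriv β γ x| ≤ δ)
    {y : V → ℝ} (hy : ∀ u, 0 ≤ y u) (n : ℕ) :
    ∀ X : Finset V, Xᶜ.card ≤ n → ∀ w ∉ X, ∀ W ∈ fieldClass G β γ X,
      0 < total (tilt W w (spinInd 1)) → 0 < total (tilt W w (spinInd (-1))) →
      influenceSum y W w ≤ ∑ l ∈ Finset.range n, δ ^ l * walkSum G y l X w := by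
  -- The number of vertices outside `X` decreases at each step because `w` joins `X`; it also limits
  -- the lengths of the walks.
  induction n with
  | zero =>
    intro X hX w hw
    exact absurd (Finset.mem_compl.2 hw) (by simp [Finset.card_eq_zero.1 (Nat.le_zero.1 hX)])
  | succ n ih =>
    intro X hX w hw W hW hpos1 hpos2
    have hW0 := (fieldClosed_fieldClass G hβ hγ X).nonneg W hW
    obtain ⟨W', hW', c, hc, hsum⟩ := exists_attach_eq G hw hW
    set N := G.neighborFinset w \ X with hN
    -- The test function `1` gives the masses, the indicator of spin `+1` at `u ≠ w` the numerators
    -- of the marginals; the constant `c s` cancels.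
    have htot : ∀ s, total (tilt W w (spinInd s)) = c s * total (attach β γ W' N s) := by
      intro s
      simpa [total] using hsum s (fun _ => 1) fun _ _ _ => rfl
    have hprob : ∀ s, 0 < total (tilt W w (spinInd s)) → ∀ u ≠ w,
        plusProb (tilt W w (spinInd s)) u = plusProb (attach β γ W' N s) u := by
      intro s hs u hu
      have h1 := hsum s (fun σ => spinInd 1 (σ u)) fun σ σ' h => by rw [h u hu]
      have hcs : c s ≠ 0 := by
        rintro h0
        rw [htot, h0, zero_mul] at hs
        exact lt_irrefl _ hs
      change _ / _ = _ / _
      rw [htot, show total (tilt (tilt W w (spinInd s)) u (spinInd 1)) =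
        c s * total (tilt (attach β γ W' N s) u (spinInd 1)) from h1,
        mul_div_mul_left _ _ hcs]
    have hcard : (insert w X)ᶜ.card ≤ n := by
      have h1 : (insert w X)ᶜ ⊂ Xᶜ := by
        rw [Finset.compl_ssubset_compl]
        exact Finset.ssubset_insert hw
      have := Finset.card_lt_card h1
      omega
    have hnext := (fieldClosed_fieldClass G hβ hγ (insert w X)).sum_abs_plusProb_attach_sub_le
      hβ hγ hδ0 hδ hy
      (c := fun v => ∑ l ∈ Finset.range n, δ ^ l * walkSum G y l (insert w X) v)
      (fun v => Finset.sum_nonneg fun l _ =>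
        mul_nonneg (pow_nonneg hδ0 l) (walkSum_nonneg G hy l _ v)) N
      (fun v hv W hW h1 h2 => ih (insert w X) hcard v (by
        simp only [hN, Finset.mem_sdiff, SimpleGraph.mem_neighborFinset] at hv
        simp only [Finset.mem_insert, not_or]
        exact ⟨hv.1.ne', hv.2⟩) W hW h1 h2) W' hW' (by
        rw [htot] at hpos1
        exact pos_of_mul_pos_right hpos1 (hc 1))
    -- A walk either stays at `w`, which pays for the influence of `w` on itself, or steps to some
    -- `v` in `N` and then avoids `insert w X`.
    have hrhs : ∑ l ∈ Finset.range (n + 1), δ ^ l * walkSum G y l X w =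
        δ * ∑ v ∈ N, ∑ l ∈ Finset.range n, δ ^ l * walkSum G y l (insert w X) v + y w := by
      rw [Finset.sum_range_succ', Finset.sum_comm, Finset.mul_sum]
      congr 1
      · refine Finset.sum_congr rfl fun l _ => ?_
        rw [← Finset.mul_sum, ← mul_assoc, ← pow_succ']
        rfl
      · simp [walkSum]
    rw [hrhs]
    unfold influenceSum
    rw [← Finset.sum_erase_add _ _ (Finset.mem_univ w)]
    refine add_le_add (le_trans ?_ hnext) ?_
    · rw [← Finset.sum_erase_add Finset.univ _ (Finset.mem_univ w)]
      refine le_trans (Finset.sum_le_sum fun u hu => ?_)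
        (le_add_of_nonneg_right (mul_nonneg (hy w) (abs_nonneg _)))
      rw [hprob 1 hpos1 u (Finset.ne_of_mem_erase hu),
        hprob (-1) hpos2 u (Finset.ne_of_mem_erase hu)]
    · refine mul_le_of_le_one_right (hy w) (abs_sub_le_iff.2 ?_)
      have hn : ∀ s, ∀ σ, 0 ≤ tilt W w (spinInd s) σ :=
        fun s => tilt_nonneg hW0 w (spinInd_nonneg s)
      have h1 := plusProb_nonneg (hn 1) w
      have h2 := plusProb_le_one (hn 1) w
      have h3 := plusProb_nonneg (hn (-1)) w
      have h4 := plusProb_le_one (hn (-1)) w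
      constructor <;> linarith

/-- The weight function of a pinned Gibbs distribution is given by external fields. -/
theorem weight_mul_indicator_mem_fieldClass (G : SimpleGraph V) [DecidableRel G.Adj]
    (β γ : ℝ) {lam : ℝ} (hlam : 0 < lam) (Λ : Finset V) (τ : {v // v ∈ Λ} → ℤˣ) :
    (pinned Λ τ).indicator (weight G β γ lam) ∈ fieldClass G β γ ∅ := by
  -- Pinning is a field with values `0` and `1`.
  refine ⟨fun v t => (if t = 1 then lam else 1) *
    if ∀ h : v ∈ Λ, t = τ ⟨v, h⟩ then 1 else 0, fun v t => ?_, ?_⟩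
  · refine mul_nonneg ?_ ?_ <;> split_ifs <;> simp [hlam.le]
  · funext σ
    have h1 : weight G β γ lam σ = (∏ v, if σ v = 1 then lam else 1) *
        ∏ e ∈ G.edgeFinset, edgeFactor β γ σ e := by
      simp only [weight, numPlus, numMono, edgeFactor, Finset.prod_mul_distrib,
        Finset.prod_ite, Finset.prod_const]
      ring
    unfold fieldWeight
    rw [Finset.prod_mul_distrib]
    simp only [Finset.notMem_empty, false_implies, implies_true, Finset.filter_true]
    by_cases hσ : σ ∈ pinned Λ τ
    · rw [Set.indicator_of_mem hσ, Finset.prod_eq_one (f := fun v => if ∀ h : v ∈ Λ, σ v = τ ⟨v, h⟩ then (1 : ℝ) else 0)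
        fun v _ => if_pos fun h => hσ ⟨v, h⟩, mul_one, h1]
    · obtain ⟨v, hv⟩ : ∃ v : {v // v ∈ Λ}, σ v ≠ τ v := by simpa [pinned] using hσ
      rw [Set.indicator_of_notMem hσ, Finset.prod_eq_zero
        (f := fun v => if ∀ h : v ∈ Λ, σ v = τ ⟨v, h⟩ then (1 : ℝ) else 0)
        (Finset.mem_univ v.1) (if_neg fun h => hv (h v.2)), mul_zero, zero_mul]

end GraphWeights

/-! ### Counting walks by degrees and by the non-backtracking matrix -/

section Walks

variable {V : Type*} [Fintype V] [DecidableEq V] (G : SimpleGraph V) [DecidableRel G.Adj]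

/-- The sum of `y` over the neighbours. -/
def nbrSum (y : V → ℝ) (w : V) : ℝ := ∑ v ∈ G.neighborFinset w, y v

theorem nbrSum_iterate_nonneg {y : V → ℝ} (hy : ∀ u, 0 ≤ y u) (l : ℕ) (w : V) :
    0 ≤ (nbrSum G)^[l] y w := by
  induction l generalizing w with
  | zero => exact hy w
  | succ l ih =>
    rw [Function.iterate_succ_apply']
    exact Finset.sum_nonneg fun v _ => ih v

theorem walkSum_le_nbrSum_iterate {y : V → ℝ} (hy : ∀ u, 0 ≤ y u) (l : ℕ) (X : Finset V)
    (w : V) : walkSum G y l X w ≤ (nbrSum G)^[l] y w := by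
  induction l generalizing X w with
  | zero => exact le_rfl
  | succ l ih =>
    rw [Function.iterate_succ_apply']
    exact (Finset.sum_le_sum fun v _ => ih _ v).trans
      (Finset.sum_le_sum_of_subset_of_nonneg Finset.sdiff_subset
        fun v _ _ => nbrSum_iterate_nonneg G hy l v)

/-- Double counting: `y v` occurs once for each neighbour of `v`. -/
theorem sum_nbrSum_le {y : V → ℝ} (hy : ∀ u, 0 ≤ y u) :
    ∑ w, nbrSum G y w ≤ G.maxDegree * ∑ w, y w := by
  have h : ∑ w, nbrSum G y w = ∑ v, (G.degree v : ℝ) * y v := by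
    unfold nbrSum
    rw [Finset.sum_comm' (s' := fun v => G.neighborFinset v) (t' := Finset.univ)
      (by simp [SimpleGraph.adj_comm])]
    simp
  rw [h, Finset.mul_sum]
  exact Finset.sum_le_sum fun v _ =>
    mul_le_mul_of_nonneg_right (mod_cast G.degree_le_maxDegree v) (hy v)

theorem sum_nbrSum_iterate_le {y : V → ℝ} (hy : ∀ u, 0 ≤ y u) (l : ℕ) :
    ∑ w, (nbrSum G)^[l] y w ≤ (G.maxDegree : ℝ) ^ l * ∑ w, y w := by
  induction l with
  | zero => simp
  | succ l ih =>
    rw [Function.iterate_succ_apply']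
    refine (sum_nbrSum_le G (nbrSum_iterate_nonneg G hy l)).trans ?_
    rw [pow_succ', mul_assoc]
    exact mul_le_mul_of_nonneg_left ih (Nat.cast_nonneg _)

theorem nbrSum_iterate_one_le (l : ℕ) (w : V) :
    (nbrSum G)^[l] (fun _ => 1) w ≤ (G.maxDegree : ℝ) ^ l := by
  induction l generalizing w with
  | zero => simp
  | succ l ih =>
    rw [Function.iterate_succ_apply']
    refine (Finset.sum_le_sum fun v _ => ih v).trans ?_
    rw [Finset.sum_const, nsmul_eq_mul, pow_succ', SimpleGraph.card_neighborFinset_eq_degree]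
    exact mul_le_mul_of_nonneg_right (mod_cast G.degree_le_maxDegree w) (by positivity)

/-- Cauchy–Schwarz on each neighbourhood and double counting cost one factor `G.maxDegree` each. -/
theorem sum_sq_nbrSum_le (y : V → ℝ) :
    ∑ w, nbrSum G y w ^ 2 ≤ (G.maxDegree : ℝ) ^ 2 * ∑ w, y w ^ 2 := by
  have h1 : ∀ w, nbrSum G y w ^ 2 ≤ G.maxDegree * nbrSum G (fun v => y v ^ 2) w := by
    intro w
    refine (sq_sum_le_card_mul_sum_sq).trans ?_
    rw [SimpleGraph.card_neighborFinset_eq_degree]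
    exact mul_le_mul_of_nonneg_right (mod_cast G.degree_le_maxDegree w)
      (Finset.sum_nonneg fun v _ => sq_nonneg _)
  refine (Finset.sum_le_sum fun w _ => h1 w).trans ?_
  rw [← Finset.mul_sum, sq, mul_assoc]
  exact mul_le_mul_of_nonneg_left (sum_nbrSum_le G fun v => sq_nonneg _) (Nat.cast_nonneg _)

theorem sum_sq_nbrSum_iterate_le (y : V → ℝ) (l : ℕ) :
    ∑ w, (nbrSum G)^[l] y w ^ 2 ≤ ((G.maxDegree : ℝ) ^ l) ^ 2 * ∑ w, y w ^ 2 := by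
  induction l with
  | zero => simp
  | succ l ih =>
    rw [Function.iterate_succ_apply']
    refine (sum_sq_nbrSum_le G _).trans ?_
    rw [pow_succ' (G.maxDegree : ℝ) l, mul_pow, mul_assoc]
    exact mul_le_mul_of_nonneg_left ih (by positivity)

variable {G}

/-- The vertices of a self-avoiding walk other than its end point. -/
def SAW.past {k : ℕ} (p : SAW G k) : Finset V :=
  Finset.univ.image fun i : Fin k => p.1 i.castSucc

/-- A self-avoiding walk extended by one step. -/
def SAW.extend {k : ℕ} (p : SAW G k) (v : V)
    (hv : v ∈ G.neighborFinset (p.1 (Fin.last k)) \ p.past) : SAW G (k + 1) :=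
  ⟨Fin.snoc p.1 v, by
    rw [Finset.mem_sdiff, SimpleGraph.mem_neighborFinset] at hv
    constructor
    · rw [Fin.snoc_injective_iff]
      refine ⟨p.2.1, ?_⟩
      rintro ⟨i, hi⟩
      induction i using Fin.lastCases with
      | last => exact hv.1.ne hi
      | cast i => exact hv.2 (Finset.mem_image.2 ⟨i, Finset.mem_univ _, hi⟩)
    · intro i
      rw [Fin.snoc_castSucc]
      induction i using Fin.lastCases with
      | last => rw [Fin.succ_last, Fin.snoc_last]; exact hv.1
      | cast i => rw [Fin.succ_castSucc, Fin.snoc_castSucc]; exact p.2.2 i⟩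

/-- A self-avoiding walk without its last step. -/
def SAW.init {k : ℕ} (q : SAW G (k + 1)) : SAW G k :=
  ⟨fun i => q.1 i.castSucc, fun i j h => Fin.castSucc_injective _ (q.2.1 h), fun i => by
    have := q.2.2 i.castSucc
    rwa [Fin.succ_castSucc] at this⟩

variable (G)

/-- Extending by a step and cutting off the last step are inverse bijections, and the past of the
extended walk is exactly the set that `walkSum` avoids after that step. -/
theorem sum_walkSum_succ (y : V → ℝ) (j m : ℕ) (w : V) :
    ∑ p : SAW G j with p.1 0 = w, walkSum G y (m + 1) p.past (p.1 (Fin.last j)) =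
      ∑ q : SAW G (j + 1) with q.1 0 = w, walkSum G y m q.past (q.1 (Fin.last (j + 1))) := by
  simp only [walkSum]
  rw [Finset.sum_sigma']
  refine Finset.sum_bij' (fun a ha => a.1.extend a.2 (Finset.mem_sigma.1 ha).2)
    (fun q _ => ⟨q.init, q.1 (Fin.last _)⟩) ?_ ?_ ?_ ?_ ?_
  · rintro ⟨p, v⟩ ha
    simp only [Finset.mem_sigma, Finset.mem_filter, Finset.mem_univ, true_and] at ha ⊢
    exact (Fin.snoc_castSucc (α := fun _ => V) v p.1 0).trans ha.1
  · intro q hq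
    simp only [Finset.mem_sigma, Finset.mem_filter, Finset.mem_univ, true_and,
      Finset.mem_sdiff, SimpleGraph.mem_neighborFinset] at hq ⊢
    refine ⟨hq, q.2.2 (Fin.last j), ?_⟩
    simp only [SAW.past, SAW.init, Finset.mem_image, Finset.mem_univ, true_and, not_exists]
    intro i hi
    exact (Fin.castSucc_lt_last i.castSucc).ne (q.2.1 hi)
  · rintro ⟨p, v⟩ ha
    have h1 : SAW.init (p.extend v (Finset.mem_sigma.1 ha).2) = p := by
      refine Subtype.ext (funext fun i => ?_)
      exact Fin.snoc_castSucc (α := fun _ => V) v p.1 i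
    have h2 : (p.extend v (Finset.mem_sigma.1 ha).2).1 (Fin.last (j + 1)) = v :=
      Fin.snoc_last (α := fun _ => V) v p.1
    simp only [h1, h2]
  · intro q hq
    refine Subtype.ext (funext fun i => ?_)
    change Fin.snoc (α := fun _ => V) (fun i : Fin (j + 1) => q.1 i.castSucc)
      (q.1 (Fin.last _)) i = q.1 i
    induction i using Fin.lastCases with
    | last => rw [Fin.snoc_last]
    | cast i => rw [Fin.snoc_castSucc]
  · rintro ⟨p, v⟩ ha
    have h2 : (p.extend v (Finset.mem_sigma.1 ha).2).1 (Fin.last (j + 1)) = v :=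
      Fin.snoc_last (α := fun _ => V) v p.1
    have h3 : (p.extend v (Finset.mem_sigma.1 ha).2).past =
        insert (p.1 (Fin.last j)) p.past := by
      have h4 : ∀ i : Fin (j + 1),
          (p.extend v (Finset.mem_sigma.1 ha).2).1 i.castSucc = p.1 i :=
        fun i => Fin.snoc_castSucc (α := fun _ => V) v p.1 i
      ext x
      simp only [SAW.past, h4, Finset.mem_image, Finset.mem_univ, true_and, Finset.mem_insert]
      rw [Fin.exists_fin_succ', or_comm, eq_comm (a := x)]
    rw [h2, h3]

/-- Cutting self-avoiding walks after their first `j` steps. -/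
theorem walkSum_add_eq_sum (y : V → ℝ) (j m : ℕ) (w : V) :
    walkSum G y (j + m) ∅ w =
      ∑ p : SAW G j with p.1 0 = w, walkSum G y m p.past (p.1 (Fin.last j)) := by
  induction j generalizing m with
  | zero =>
    have hs : (Finset.univ.filter fun p : SAW G 0 => p.1 0 = w) =
        {⟨fun _ => w, fun i j _ => Subsingleton.elim (α := Fin 1) i j, fun i => i.elim0⟩} := by
      ext p
      simp only [Finset.mem_filter, Finset.mem_univ, true_and, Finset.mem_singleton]
      refine ⟨fun h => Subtype.ext (funext fun i => ?_), fun h => by rw [h]⟩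
      rw [Subsingleton.elim (α := Fin 1) i 0, h]
    rw [hs, Finset.sum_singleton, zero_add]
    rfl
  | succ j ih => rw [← sum_walkSum_succ, ← ih (m + 1)]; congr 1; omega

theorem card_saw_le (k : ℕ) (w : V) :
    ((Finset.univ.filter fun p : SAW G k => p.1 0 = w).card : ℝ) ≤ (G.maxDegree : ℝ) ^ k := by
  have h := walkSum_add_eq_sum G (fun _ => 1) k 0 w
  simp only [walkSum, Finset.sum_const, nsmul_eq_mul, mul_one] at h
  rw [← h]
  exact (walkSum_le_nbrSum_iterate G (fun _ => zero_le_one) _ _ _).trans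
    (nbrSum_iterate_one_le G k w)

theorem sum_saw_last_le {y : V → ℝ} (hy : ∀ u, 0 ≤ y u) (k : ℕ) :
    ∑ p : SAW G k, y (p.1 (Fin.last k)) ≤ (G.maxDegree : ℝ) ^ k * ∑ w, y w := by
  rw [← Finset.sum_fiberwise Finset.univ (fun p : SAW G k => p.1 0)]
  refine le_trans (Finset.sum_le_sum fun w _ => ?_) (sum_nbrSum_iterate_le G hy k)
  exact (walkSum_add_eq_sum G y k 0 w).symm.le.trans (walkSum_le_nbrSum_iterate G hy k ∅ w)

/-- Cauchy–Schwarz over the at most `G.maxDegree ^ k` walks from each `w`. -/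
theorem sum_sq_sum_saw_le (k : ℕ) (z : SAW G k → ℝ) :
    ∑ w, (∑ p : SAW G k with p.1 0 = w, z p) ^ 2 ≤ (G.maxDegree : ℝ) ^ k * ∑ p, z p ^ 2 := by
  rw [← Finset.sum_fiberwise Finset.univ (fun p : SAW G k => p.1 0), Finset.mul_sum]
  refine Finset.sum_le_sum fun w _ => sq_sum_le_card_mul_sum_sq.trans ?_
  exact mul_le_mul_of_nonneg_right (card_saw_le G k w)
    (Finset.sum_nonneg fun p _ => sq_nonneg _)

theorem nonBacktracking_nonneg {k : ℕ} (P Q : SAW G k) : 0 ≤ nonBacktracking G k P Q := by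
  simp only [nonBacktracking, Matrix.of_apply]
  split_ifs <;> norm_num

theorem nonBacktracking_pow_mulVec_nonneg {k : ℕ} {z : SAW G k → ℝ} (hz : ∀ P, 0 ≤ z P)
    (q : ℕ) (P : SAW G k) : 0 ≤ (nonBacktracking G k ^ q).mulVec z P := by
  induction q generalizing P with
  | zero => simpa using hz P
  | succ q ih =>
    rw [pow_succ', ← Matrix.mulVec_mulVec]
    exact Finset.sum_nonneg fun Q _ => mul_nonneg (nonBacktracking_nonneg G P Q) (ih Q)

variable {G} in
/-- A walk moved on by one step, keeping its length. -/
def SAW.shift {k : ℕ} (p : SAW G k) (v : V)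
    (hv : v ∈ G.neighborFinset (p.1 (Fin.last k)) \ p.past) : SAW G k :=
  ⟨fun i => (p.extend v hv).1 i.succ, fun i j h => Fin.succ_injective _
    ((p.extend v hv).2.1 h), fun i => by
    have := (p.extend v hv).2.2 i.succ
    rwa [← Fin.succ_castSucc] at this⟩

theorem SAW.shift_last {k : ℕ} (p : SAW G k) (v : V)
    (hv : v ∈ G.neighborFinset (p.1 (Fin.last k)) \ p.past) :
    (p.shift v hv).1 (Fin.last k) = v := by
  change (p.extend v hv).1 (Fin.last k).succ = v
  rw [Fin.succ_last]
  exact Fin.snoc_last (α := fun _ => V) v p.1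

theorem SAW.shift_castSucc {k : ℕ} (p : SAW G k) (v : V)
    (hv : v ∈ G.neighborFinset (p.1 (Fin.last k)) \ p.past) (i : Fin k) :
    (p.shift v hv).1 i.castSucc = p.1 i.succ := by
  change (p.extend v hv).1 i.castSucc.succ = _
  rw [Fin.succ_castSucc]
  exact Fin.snoc_castSucc (α := fun _ => V) v p.1 i.succ

/-- The extended walk has `k + 2` distinct vertices; that its first and last differ is the condition
`x_0 ≠ z_k`. -/
theorem nonBacktracking_shift {k : ℕ} (p : SAW G k) (v : V)
    (hv : v ∈ G.neighborFinset (p.1 (Fin.last k)) \ p.past) :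
    nonBacktracking G k p (p.shift v hv) = 1 := by
  simp only [nonBacktracking, Matrix.of_apply]
  refine if_pos ⟨fun h => ?_, fun i => p.shift_castSucc G v hv i⟩
  rw [p.shift_last] at h
  have h0 : (p.extend v hv).1 (Fin.castSucc 0) = (p.extend v hv).1 (Fin.last (k + 1)) := by
    refine (Fin.snoc_castSucc (α := fun _ => V) v p.1 0).trans (h.trans ?_)
    exact (Fin.snoc_last (α := fun _ => V) v p.1).symm
  exact (Fin.castSucc_lt_last (0 : Fin (k + 1))).ne ((p.extend v hv).2.1 h0)

/-- The continuations of a self-avoiding walk whose last `k` steps are `P` are counted by powers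
of the `k`-non-backtracking matrix. -/
theorem walkSum_le_nonBacktracking_pow {y : V → ℝ} (hy : ∀ u, 0 ≤ y u) {k : ℕ} (q r : ℕ)
    (X : Finset V) (P : SAW G k) (hX : P.past ⊆ X) :
    walkSum G y (q + r) X (P.1 (Fin.last k)) ≤
      (nonBacktracking G k ^ q).mulVec (fun Q => (nbrSum G)^[r] y (Q.1 (Fin.last k))) P := by
  induction q generalizing X P with
  | zero => simpa using walkSum_le_nbrSum_iterate G hy r X _
  | succ q ih =>
    rw [pow_succ', ← Matrix.mulVec_mulVec, show q + 1 + r = q + r + 1 by omega]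
    set z := (nonBacktracking G k ^ q).mulVec
      (fun Q => (nbrSum G)^[r] y (Q.1 (Fin.last k))) with hz
    have hz0 : ∀ Q, 0 ≤ z Q := nonBacktracking_pow_mulVec_nonneg G
      (fun Q => nbrSum_iterate_nonneg G hy r _) q
    simp only [walkSum]
    set T := G.neighborFinset (P.1 (Fin.last k)) \ X with hT
    have hmem : ∀ v ∈ T, v ∈ G.neighborFinset (P.1 (Fin.last k)) \ P.past := fun v hv =>
      Finset.sdiff_subset_sdiff le_rfl hX hv
    -- The invariant `past ⊆ X` survives: the past of the shifted walk consists of vertices of `P`,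
    -- all in `insert (P.1 (Fin.last k)) X`.
    have h1 : ∀ v : {v // v ∈ T}, walkSum G y (q + r) (insert (P.1 (Fin.last k)) X) v ≤
        nonBacktracking G k P (P.shift v.1 (hmem v.1 v.2)) * z (P.shift v.1 (hmem v.1 v.2)) := by
      intro v
      rw [nonBacktracking_shift, one_mul]
      have h := ih (insert (P.1 (Fin.last k)) X) (P.shift v.1 (hmem v.1 v.2)) ?_
      · rwa [P.shift_last] at h
      · intro x hx
        simp only [SAW.past, Finset.mem_image, Finset.mem_univ, true_and] at hx
        obtain ⟨i, rfl⟩ := hx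
        rw [P.shift_castSucc, Finset.mem_insert]
        generalize i.succ = j
        induction j using Fin.lastCases with
        | last => exact Or.inl rfl
        | cast j => exact Or.inr (hX (Finset.mem_image_of_mem _ (Finset.mem_univ j)))
    -- Shifted walks are distinguished by their end point `v`, so they occupy distinct columns of
    -- row `P`; the other columns contribute nonnegative terms.
    rw [← Finset.sum_attach]
    refine (Finset.sum_le_sum fun v _ => h1 v).trans ?_
    rw [← Finset.sum_image (s := T.attach)
      (f := fun Q => nonBacktracking G k P Q * z Q)
      (g := fun v => P.shift v.1 (hmem v.1 v.2)) ?_]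
    · exact Finset.sum_le_sum_of_subset_of_nonneg (Finset.subset_univ _) fun Q _ _ =>
        mul_nonneg (nonBacktracking_nonneg G P Q) (hz0 Q)
    · intro v _ v' _ h
      have := congrArg (fun Q : SAW G k => Q.1 (Fin.last k)) h
      simp only [P.shift_last] at this
      exact Subtype.ext this

end Walks

/-! ### Growth in `ℓ²` and the geometric series -/

section Norms

theorem sum_sq_mulVec_pow_le {ι : Type*} [Fintype ι] [DecidableEq ι] (A : Matrix ι ι ℝ)
    (q : ℕ) (z : ι → ℝ) :
    ∑ i, (A ^ q).mulVec z i ^ 2 ≤ (specNorm A ^ q) ^ 2 * ∑ i, z i ^ 2 := by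
  induction q with
  | zero => simp
  | succ q ih =>
    have h := (Matrix.toEuclideanCLM (n := ι) (𝕜 := ℝ) A).le_opNorm
      (WithLp.toLp 2 ((A ^ q).mulVec z))
    have h2 := pow_le_pow_left₀ (norm_nonneg _) h 2
    rw [Matrix.toEuclideanCLM_toLp, Matrix.mulVec_mulVec, ← pow_succ', mul_pow,
      EuclideanSpace.real_norm_sq_eq, EuclideanSpace.real_norm_sq_eq] at h2
    refine h2.trans ?_
    rw [pow_succ' (specNorm A) q, mul_pow, mul_assoc]
    exact mul_le_mul_of_nonneg_left ih (sq_nonneg _)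

variable {V : Type*} [Fintype V] [DecidableEq V] (G : SimpleGraph V) [DecidableRel G.Adj]

/-- The growth of the numbers of self-avoiding walks in terms of the norm of a power of the
`k`-non-backtracking matrix. -/
theorem sum_sq_walkSum_le {ρ : ℝ} (hρ : 1 ≤ ρ) (hΔ : 1 ≤ G.maxDegree) {k N : ℕ} (hN : 1 ≤ N)
    (hspec : specNorm (nonBacktracking G k ^ N) = ρ ^ N) {y : V → ℝ} (hy : ∀ u, 0 ≤ y u)
    (l : ℕ) :
    ∑ w, walkSum G y l ∅ w ^ 2 ≤ ((G.maxDegree : ℝ) ^ (k + N) * ρ ^ l) ^ 2 * ∑ w, y w ^ 2 := by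
  have hΔ' : (1 : ℝ) ≤ G.maxDegree := by exact_mod_cast hΔ
  have hy2 : 0 ≤ ∑ w, y w ^ 2 := Finset.sum_nonneg fun w _ => sq_nonneg _
  rcases lt_or_ge l k with hl | hl
  · have h1 : ∑ w, walkSum G y l ∅ w ^ 2 ≤ ∑ w, (nbrSum G)^[l] y w ^ 2 :=
      Finset.sum_le_sum fun w _ => pow_le_pow_left₀ (walkSum_nonneg G hy l ∅ w)
        (walkSum_le_nbrSum_iterate G hy l ∅ w) 2
    refine (h1.trans (sum_sq_nbrSum_iterate_le G y l)).trans ?_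
    refine mul_le_mul_of_nonneg_right (pow_le_pow_left₀ (by positivity) ?_ 2) hy2
    calc (G.maxDegree : ℝ) ^ l ≤ (G.maxDegree : ℝ) ^ (k + N) :=
          pow_le_pow_right₀ hΔ' (by omega)
      _ ≤ _ := le_mul_of_one_le_right (by positivity) (one_le_pow₀ hρ)
  · obtain ⟨m, rfl⟩ := Nat.exists_eq_add_of_le hl
    -- Only the norm of the `N`-th power is known. After the initial `k` steps, the walk is cut into
    -- `q` blocks of length `N` and a remainder `r < N` that is bounded by degrees.
    set q := m / N with hq
    set r := m % N with hr
    have hm : m = N * q + r := (Nat.div_add_mod m N).symm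
    set z : SAW G k → ℝ := fun Q => (nbrSum G)^[r] y (Q.1 (Fin.last k)) with hz
    set Z := (nonBacktracking G k ^ (N * q)).mulVec z with hZ
    have h1 : ∀ w, walkSum G y (k + m) ∅ w ≤ ∑ p : SAW G k with p.1 0 = w, Z p := by
      intro w
      rw [walkSum_add_eq_sum]
      refine Finset.sum_le_sum fun p _ => ?_
      conv_lhs => rw [hm]
      exact walkSum_le_nonBacktracking_pow G hy (N * q) r _ p subset_rfl
    have h2 : ∑ p, Z p ^ 2 ≤ (ρ ^ (N * q)) ^ 2 * ∑ p, z p ^ 2 := by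
      have := sum_sq_mulVec_pow_le (nonBacktracking G k ^ N) q z
      rwa [← pow_mul, hspec, ← pow_mul ρ N q] at this
    have h3 : ∑ p, z p ^ 2 ≤
        (G.maxDegree : ℝ) ^ k * (((G.maxDegree : ℝ) ^ r) ^ 2 * ∑ w, y w ^ 2) :=
      (sum_saw_last_le G (y := fun v => (nbrSum G)^[r] y v ^ 2) (fun _ => sq_nonneg _) k).trans
        (mul_le_mul_of_nonneg_left (sum_sq_nbrSum_iterate_le G y r) (by positivity))
    -- The multiplicities of starting points and of end points each cost `G.maxDegree ^ k` in the
    -- squared norm, hence together `G.maxDegree ^ k` in the norm.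
    calc ∑ w, walkSum G y (k + m) ∅ w ^ 2
        ≤ ∑ w, (∑ p : SAW G k with p.1 0 = w, Z p) ^ 2 :=
          Finset.sum_le_sum fun w _ => pow_le_pow_left₀ (walkSum_nonneg G hy _ ∅ w) (h1 w) 2
      _ ≤ (G.maxDegree : ℝ) ^ k * ∑ p, Z p ^ 2 := sum_sq_sum_saw_le G k Z
      _ ≤ (G.maxDegree : ℝ) ^ k * ((ρ ^ (N * q)) ^ 2 * ((G.maxDegree : ℝ) ^ k *
          (((G.maxDegree : ℝ) ^ r) ^ 2 * ∑ w, y w ^ 2))) := by gcongr; exact h2.trans (by gcongr)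
      _ = ((G.maxDegree : ℝ) ^ (k + r) * ρ ^ (N * q)) ^ 2 * ∑ w, y w ^ 2 := by ring
      _ ≤ _ := by
        have hrN : r < N := Nat.mod_lt m hN
        refine mul_le_mul_of_nonneg_right (pow_le_pow_left₀ (by positivity) ?_ 2) hy2
        exact mul_le_mul (pow_le_pow_right₀ hΔ' (by omega)) (pow_le_pow_right₀ hρ (by omega))
          (by positivity) (by positivity)

theorem norm_toLp_le_of_sum_sq_le {c : ℝ} (hc : 0 ≤ c) {x y : V → ℝ}
    (h : ∑ w, x w ^ 2 ≤ c ^ 2 * ∑ w, y w ^ 2) :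
    ‖(WithLp.toLp 2 x : EuclideanSpace ℝ V)‖ ≤ c * ‖(WithLp.toLp 2 y : EuclideanSpace ℝ V)‖ := by
  refine le_of_sq_le_sq ?_ (by positivity)
  rw [mul_pow, EuclideanSpace.real_norm_sq_eq, EuclideanSpace.real_norm_sq_eq]
  exact h

/-- If `κ y` is dominated entrywise by the sums of a nonzero vector `y ≥ 0` over the end points
of self-avoiding walks, discounted by `δ = (1 - ε) / ρ` per step, then `κ` is of order `ε⁻¹`. -/
theorem le_of_mul_le_sum_walkSum {ρ δ ε : ℝ} (hρ : 1 ≤ ρ) (hε0 : 0 < ε) (hε1 : ε < 1)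
    (hδ : δ = (1 - ε) / ρ) (hΔ : 1 ≤ G.maxDegree) {k N : ℕ} (hN : 1 ≤ N)
    (hspec : specNorm (nonBacktracking G k ^ N) = ρ ^ N) {y : V → ℝ} (hy : ∀ u, 0 ≤ y u)
    {v : V} (hv : y v ≠ 0) {κ : ℝ} (hκ : 0 ≤ κ) {n : ℕ}
    (h : ∀ w, κ * y w ≤ ∑ l ∈ Finset.range n, δ ^ l * walkSum G y l ∅ w) :
    κ ≤ (G.maxDegree : ℝ) ^ (k + N) * ε⁻¹ := by
  have hρ0 : 0 < ρ := by linarith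
  have hδ0 : 0 ≤ δ := by rw [hδ]; exact div_nonneg (by linarith) hρ0.le
  have hypos : 0 < ‖(WithLp.toLp 2 y : EuclideanSpace ℝ V)‖ := by
    rw [norm_pos_iff]
    intro h0
    exact hv (by simpa using congrArg (fun x : EuclideanSpace ℝ V => x v) h0)
  set Y := ‖(WithLp.toLp 2 y : EuclideanSpace ℝ V)‖ with hY
  set D := (G.maxDegree : ℝ) ^ (k + N) with hD
  have hD0 : 0 ≤ D := by positivity
  have h1 : κ * Y ≤ ‖(WithLp.toLp 2 (fun w => ∑ l ∈ Finset.range n,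
      δ ^ l * walkSum G y l ∅ w) : EuclideanSpace ℝ V)‖ := by
    rw [hY, ← abs_of_nonneg hκ, ← Real.norm_eq_abs, ← norm_smul]
    refine le_of_sq_le_sq ?_ (norm_nonneg _)
    rw [EuclideanSpace.real_norm_sq_eq, EuclideanSpace.real_norm_sq_eq]
    exact Finset.sum_le_sum fun w _ => pow_le_pow_left₀ (mul_nonneg hκ (hy w)) (h w) 2
  have h2 : (WithLp.toLp 2 (fun w => ∑ l ∈ Finset.range n,
      δ ^ l * walkSum G y l ∅ w) : EuclideanSpace ℝ V) =
      ∑ l ∈ Finset.range n, δ ^ l • (WithLp.toLp 2 (walkSum G y l ∅) : EuclideanSpace ℝ V) := by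
    ext w
    simp [WithLp.ofLp_sum, Finset.sum_apply]
  -- This is `δ ^ l * ρ ^ l = (1 - ε) ^ l`.
  have h3 : ∀ l, ‖δ ^ l • (WithLp.toLp 2 (walkSum G y l ∅) : EuclideanSpace ℝ V)‖ ≤
      (1 - ε) ^ l * (D * Y) := by
    intro l
    rw [norm_smul, Real.norm_of_nonneg (pow_nonneg hδ0 l)]
    have h4 := norm_toLp_le_of_sum_sq_le (by positivity)
      (sum_sq_walkSum_le G hρ hΔ hN hspec hy l)
    refine (mul_le_mul_of_nonneg_left h4 (pow_nonneg hδ0 l)).trans (le_of_eq ?_)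
    rw [hδ, div_pow, ← hD, ← hY]
    have : ρ ^ l ≠ 0 := by positivity
    field_simp
  have h4 : ∑ l ∈ Finset.range n, (1 - ε) ^ l ≤ ε⁻¹ := by
    have := (summable_geometric_of_lt_one (by linarith) (by linarith : 1 - ε < 1)).sum_le_tsum
      (Finset.range n) (fun l _ => pow_nonneg (by linarith) l)
    rwa [tsum_geometric_of_lt_one (by linarith) (by linarith), sub_sub_cancel] at this
  have h5 : κ * Y ≤ D * ε⁻¹ * Y := by
    rw [h2] at h1
    refine (h1.trans (norm_sum_le_of_le _ fun l _ => h3 l)).trans ?_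
    rw [← Finset.sum_mul]
    calc _ ≤ ε⁻¹ * (D * Y) := mul_le_mul_of_nonneg_right h4 (by positivity)
      _ = _ := by ring
  exact le_of_mul_le_mul_right h5 hypos

end Norms

/-! ### From Gibbs conditional probabilities to weights -/

section Conditional

variable {V : Type*} [Fintype V] [DecidableEq V] (G : SimpleGraph V) [DecidableRel G.Adj]

theorem prob_gibbs (β γ lam : ℝ) (A : Set (V → ℤˣ)) :
    prob (gibbs G β γ lam) A =
      total (A.indicator (weight G β γ lam)) / partitionFunction G β γ lam := by
  classical
  simp only [prob, gibbs, total, Set.indicator_apply, ← Finset.sum_div, ← Finset.sum_filter]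

omit [Fintype V] [DecidableEq V] in
theorem tilt_indicator_spinInd (W : (V → ℤˣ) → ℝ) (A : Set (V → ℤˣ)) (v : V) (s : ℤˣ) :
    tilt (A.indicator W) v (spinInd s) = (A ∩ spinAt v s).indicator W := by
  funext σ
  by_cases hA : σ ∈ A <;> by_cases hs : σ v = s <;>
    simp [tilt, spinInd, spinAt, hA, hs]

theorem condProb_gibbs_inter (β γ lam : ℝ) (hZ : partitionFunction G β γ lam ≠ 0) (Λ : Finset V)
    (τ : {v // v ∈ Λ} → ℤˣ) (w u : V) (s : ℤˣ) :
    condProb (gibbs G β γ lam) (spinAt u 1) (pinned Λ τ ∩ spinAt w s) =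
      plusProb (tilt ((pinned Λ τ).indicator (weight G β γ lam)) w (spinInd s)) u := by
  rw [condProb, prob_gibbs, prob_gibbs, div_div_div_cancel_right₀ hZ, plusProb,
    tilt_indicator_spinInd, tilt_indicator_spinInd, Set.inter_comm (spinAt u 1)]

theorem marginal_gibbs (β γ lam : ℝ) (hZ : partitionFunction G β γ lam ≠ 0) (Λ : Finset V)
    (τ : {v // v ∈ Λ} → ℤˣ) (w : V) :
    marginal (gibbs G β γ lam) Λ τ w 1 =
      plusProb ((pinned Λ τ).indicator (weight G β γ lam)) w := by
  rw [marginal, condProb, prob_gibbs, prob_gibbs, div_div_div_cancel_right₀ hZ, plusProb,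
    tilt_indicator_spinInd, Set.inter_comm]

theorem total_eq_add (W : (V → ℤˣ) → ℝ) (v : V) :
    total W = total (tilt W v (spinInd 1)) + total (tilt W v (spinInd (-1))) := by
  have h := total_tilt W v fun _ => 1
  simp only [one_mul] at h
  rw [← h]
  congr 1
  funext σ
  simp [tilt]

theorem total_tilt_spinInd_pos {W : (V → ℤˣ) → ℝ} (hW : ∀ σ, 0 ≤ W σ) {w : V}
    (h0 : plusProb W w ≠ 0) (h1 : plusProb W w ≠ 1) :
    0 < total (tilt W w (spinInd 1)) ∧ 0 < total (tilt W w (spinInd (-1))) := by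
  have hA := total_nonneg (tilt_nonneg hW w (spinInd_nonneg 1))
  have hB := total_nonneg (tilt_nonneg hW w (spinInd_nonneg (-1)))
  have hA' : total (tilt W w (spinInd 1)) ≠ 0 := fun h => h0 (by rw [plusProb, h, zero_div])
  refine ⟨lt_of_le_of_ne hA hA'.symm, lt_of_le_of_ne hB fun h => h1 ?_⟩
  rw [plusProb, total_eq_add W w, ← h, add_zero, div_self hA']

/-- Every row of the influence matrix is dominated by the self-avoiding walks in `G`. -/
theorem sum_abs_influence_le {β γ lam δ : ℝ} (hβ : 0 ≤ β) (hγ : 0 < γ) (hlam : 0 < lam)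
    (hδ0 : 0 ≤ δ) (hδ : ∀ x : ℝ, |recDeriv β γ x| ≤ δ) (Λ : Finset V)
    (τ : {v // v ∈ Λ} → ℤˣ) {y : V → ℝ} (hy : ∀ u, 0 ≤ y u) (w : {v // v ∉ Λ}) :
    ∑ u, |influence (gibbs G β γ lam) Λ τ w u| * y u ≤
      ∑ l ∈ Finset.range (Fintype.card V), δ ^ l * walkSum G y l ∅ w := by
  have hrhs : 0 ≤ ∑ l ∈ Finset.range (Fintype.card V), δ ^ l * walkSum G y l ∅ w :=
    Finset.sum_nonneg fun l _ => mul_nonneg (pow_nonneg hδ0 l) (walkSum_nonneg G hy l ∅ w)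
  by_cases hm : marginal (gibbs G β γ lam) Λ τ w 1 = 0 ∨ marginal (gibbs G β γ lam) Λ τ w 1 = 1
  · refine le_trans (le_of_eq (Finset.sum_eq_zero fun u _ => ?_)) hrhs
    rw [influence, Matrix.of_apply, if_pos (by tauto), abs_zero, zero_mul]
  · rw [not_or] at hm
    -- Division by zero gives `0`, so a nonzero marginal forces a nonzero partition function.
    have hZ : partitionFunction G β γ lam ≠ 0 := fun hZ => hm.1 (by
      rw [marginal, condProb, prob_gibbs, hZ, div_zero, zero_div])
    set W := (pinned Λ τ).indicator (weight G β γ lam) with hW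
    have hmem : W ∈ fieldClass G β γ ∅ :=
      weight_mul_indicator_mem_fieldClass G β γ hlam Λ τ
    have hW0 := (fieldClosed_fieldClass G hβ hγ ∅).nonneg W hmem
    rw [marginal_gibbs G β γ lam hZ] at hm
    obtain ⟨hpos1, hpos2⟩ := total_tilt_spinInd_pos hW0 hm.1 hm.2
    refine le_trans ?_ (influenceSum_le_sum_walkSum G hβ hγ hδ0 hδ hy (Fintype.card V) ∅
      (by simp) w (Finset.notMem_empty _) W hmem hpos1 hpos2)
    unfold influenceSum
    set g : V → ℝ := fun u => y u * |plusProb (tilt W w (spinInd 1)) u -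
      plusProb (tilt W w (spinInd (-1))) u| with hg
    have hg0 : ∀ u, 0 ≤ g u := fun u => mul_nonneg (hy u) (abs_nonneg _)
    have h1 : ∀ u : {v // v ∉ Λ}, |influence (gibbs G β γ lam) Λ τ w u| * y u ≤ g u := by
      intro u
      rw [influence, Matrix.of_apply]
      split_ifs
      · rw [abs_zero, zero_mul]; exact hg0 u
      · rw [condProb_gibbs_inter G β γ lam hZ, condProb_gibbs_inter G β γ lam hZ, mul_comm]
    refine (Finset.sum_le_sum fun u _ => h1 u).trans ?_
    rw [← Fintype.sum_subtype_add_sum_subtype (fun v => v ∉ Λ) g]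
    exact le_add_of_nonneg_right (Finset.sum_nonneg fun u _ => hg0 u)

end Conditional

/-! ### Eigenvectors and the conclusion -/

/-- A bound for the spectral radius by means of entrywise absolute values of eigenvectors. -/
theorem specRadius_le_of_forall_eigenvector {ι : Type*} [Fintype ι] [DecidableEq ι]
    (A : Matrix ι ι ℝ) {c : ℝ}
    (h : ∀ (κ : ℝ) (y : ι → ℝ), 0 ≤ κ → (∀ i, 0 ≤ y i) → (∃ i, y i ≠ 0) →
      (∀ i, κ * y i ≤ ∑ j, |A i j| * y j) → κ ≤ c) :
    specRadius A ≤ ENNReal.ofReal c := by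
  refine iSup₂_le fun z hz => ?_
  rw [spectrum.mem_iff, Matrix.isUnit_iff_isUnit_det, isUnit_iff_ne_zero, not_not,
    ← Matrix.exists_mulVec_eq_zero_iff] at hz
  obtain ⟨x, hx, hzx⟩ := hz
  have hx' : ∀ i, z * x i = ∑ j, (A i j : ℂ) * x j := by
    intro i
    have := congrFun hzx i
    rw [Matrix.sub_mulVec, Algebra.algebraMap_eq_smul_one, Matrix.smul_mulVec, Matrix.one_mulVec] at this
    exact sub_eq_zero.1 this
  rw [← enorm_eq_nnnorm, ← ofReal_norm]
  refine ENNReal.ofReal_le_ofReal (h ‖z‖ (fun i => ‖x i‖) (norm_nonneg _)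
    (fun i => norm_nonneg _) ?_ fun i => ?_)
  · obtain ⟨i, hi⟩ := Function.ne_iff.1 hx
    exact ⟨i, norm_ne_zero_iff.2 hi⟩
  · rw [← norm_mul, hx']
    refine norm_sum_le_of_le _ fun j _ => ?_
    rw [norm_mul, Complex.norm_real, Real.norm_eq_abs]

/-- The case `d = 1` suffices, as the influence recursion treats one neighbour at a time. -/
theorem Contraction.abs_recDeriv_le {β γ δ : ℝ} {Δ : ℕ} (h : Contraction β γ Δ δ) (hΔ : 1 < Δ)
    (x : ℝ) : |recDeriv β γ x| ≤ δ :=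
  (norm_le_pi_norm (gradRec β γ 1 fun _ => (x : EReal)) 0).trans (h 1 le_rfl hΔ _)

end TwoSpin

theorem theorem10 (Δ N k : ℕ) (ρ b : ℝ) (hΔ : 1 < Δ) (hN : 1 ≤ N) (hk : 1 ≤ k)
    (hρ : 1 < ρ) (hb0 : 0 < b) (hb1 : b < 1) :
    ∃ C : ℝ, ∀ (V : Type*) [Fintype V] [DecidableEq V]
      (G : SimpleGraph V) [DecidableRel G.Adj] (β γ lam ε : ℝ),
      G.Connected → G.maxDegree = Δ →
      0 ≤ β → β ≤ γ → 0 < γ → 0 < lam → 0 < ε → ε < 1 →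
      TwoSpin.specNorm (TwoSpin.nonBacktracking G k ^ N) ^ (1 / (N : ℝ)) = ρ →
      TwoSpin.MarginallyBounded (TwoSpin.gibbs G β γ lam) b →
      TwoSpin.Contraction β γ Δ ((1 - ε) / ρ) →
      ∀ (Λ : Finset V) (τ : {v // v ∈ Λ} → ℤˣ),
        TwoSpin.specRadius (TwoSpin.influence (TwoSpin.gibbs G β γ lam) Λ τ) ≤
          ENNReal.ofReal (C * ε⁻¹) := by
  refine ⟨(Δ : ℝ) ^ (k + N), ?_⟩
  intro V _ _ G _ β γ lam ε _ hmax hβ _ hγ hlam hε0 hε1 hspec _ hcontr Λ τ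
  have hρ0 : 0 < ρ := by linarith
  have hδ := hcontr.abs_recDeriv_le hΔ
  have hδ0 : 0 ≤ (1 - ε) / ρ := div_nonneg (by linarith) hρ0.le
  have hspec' : TwoSpin.specNorm (TwoSpin.nonBacktracking G k ^ N) = ρ ^ N := by
    have hnn : 0 ≤ TwoSpin.specNorm (TwoSpin.nonBacktracking G k ^ N) := norm_nonneg _
    rw [← hspec, one_div, Real.rpow_inv_natCast_pow hnn (Nat.one_le_iff_ne_zero.1 hN)]
  refine TwoSpin.specRadius_le_of_forall_eigenvector _ ?_
  rintro κ y hκ hy ⟨v, hv⟩ hrow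
  -- Extending the vector by zero makes the inequality trivial on `Λ`, so walks in all of `G` can be
  -- used.
  set Y : V → ℝ := fun u => if h : u ∉ Λ then y ⟨u, h⟩ else 0 with hY
  have hY0 : ∀ u, 0 ≤ Y u := fun u => by
    simp only [hY]; split_ifs <;> simp [hy]
  have hYy : ∀ u : {v // v ∉ Λ}, Y u = y u := fun u => dif_pos u.2
  rw [← hmax]
  refine TwoSpin.le_of_mul_le_sum_walkSum G hρ.le hε0 hε1 rfl (by omega) hN hspec' hY0
    (v := v) (by rwa [hYy]) hκ (n := Fintype.card V) fun w => ?_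
  by_cases hw : w ∉ Λ
  · have h1 := hrow ⟨w, hw⟩
    have h2 := TwoSpin.sum_abs_influence_le G hβ hγ hlam hδ0 hδ Λ τ hY0 ⟨w, hw⟩
    simp only [hYy] at h2
    rw [show Y w = y ⟨w, hw⟩ from dif_pos hw]
    exact h1.trans h2
  · rw [show Y w = 0 from dif_neg hw, mul_zero]
    exact Finset.sum_nonneg fun l _ =>
      mul_nonneg (pow_nonneg hδ0 l) (TwoSpin.walkSum_nonneg G hY0 l ∅ w)
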